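/- Let $N\ge 2$, let $G=(V,E)$ be a finite connected simple graph, and fix a vertex $o\in V$. For $\beta\ge 0$ let $\sigma=(\sigma_v)_{v\in V}\in(\mathbb S^{N-1})^V$, with $\mathbb S^{N-1}\subset\mathbb R^N$ the unit sphere, be the spin $O(N)$ model on $G$ at inverse temperature $\beta$ with $\sigma_o$ rooted at the north pole. That is, $\sigma_o=(0,\dots,0,1)$, and the law of $(\sigma_v)_{v\ne o}$ is the probability measure proportional to $$\exp\Big(\beta\sum_{\{i,j\}\in E}\sigma_i\cdot\sigma_j\Big)\prod_{v\ne o}d\sigma_v ,$$ where $d\sigma_v$ is the surface measure on $\mathbb S^{N-1}$. Let $\gamma=(\gamma_v)_{v\in V}\in(\mathbb R^{N-1})^V$ be the $(N-1)$-component Gaussian free field on $G$ rooted at $0$ at $o$. That is, $\gamma_o=0$, and the law of $(\gamma_v)_{v\ne o}$ is the probability measure proportional to $$\exp\Big(-\tfrac12\sum_{\{i,j\}\in E}\|\gamma_i-\gamma_j\|^2\Big)\prod_{v\ne o}d\gamma_v ,$$ where $d\gamma_v$ is Lebesgue measure on $\mathbb R^{N-1}$. Write $\sigma_v^k$ for the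 $k$-th coordinate of $\sigma_v$. Then, as $\beta\to\infty$, $$\big(\sqrt\beta\,\sigma_v^1,\dots,\sqrt\beta\,\sigma_v^{N-1}\big)_{v\in V}\ \longrightarrow\ \gamma\quad\text{in law, as random elements of }(\mathbb R^{N-1})^V .$$ -/

import Mathlib

open MeasureTheory Filter

set_option linter.unusedSectionVars false

noncomputable section

namespace SpinON

/-- The spin space `𝕊^{N-1}`: the unit sphere of Euclidean `ℝ^N`. -/
abbrev Spin (N : ℕ) : Type := Metric.sphere (0 : EuclideanSpace ℝ (Fin N)) 1

/-- The north pole `(0, …, 0, 1)` of `𝕊^{N-1}`. -/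
def northPole (N : ℕ) (hN : 0 < N) : Spin N :=
  ⟨EuclideanSpace.single (⟨N - 1, by omega⟩ : Fin N) (1 : ℝ), by simp⟩

/-- The surface (Lebesgue) measure on `𝕊^{N-1}`. -/
def surface (N : ℕ) : Measure (Spin N) :=
  (volume : Measure (EuclideanSpace ℝ (Fin N))).toSphere

section Rooted

variable {V : Type*} [Fintype V] [DecidableEq V] {E : Type*} [MeasurableSpace E]

/-- The product measure `∏_v dφ_v` on `E^V`, in which the coordinate at the root `o` is fixed
to be `x` and all other coordinates are integrated against `ν`. -/
def rootedProduct (o : V) (x : E) (ν : Measure E) : Measure (V → E) :=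
  Measure.pi fun v => if v = o then Measure.dirac x else ν

instance rootedFamily_sigmaFinite (o : V) (x : E) (ν : Measure E) [SigmaFinite ν] (v : V) :
    SigmaFinite (if v = o then Measure.dirac x else ν) := by
  split_ifs <;> infer_instance

instance rootedFamily_isFiniteMeasure (o : V) (x : E) (ν : Measure E) [IsFiniteMeasure ν]
    (v : V) : IsFiniteMeasure (if v = o then Measure.dirac x else ν) := by
  split_ifs <;> infer_instance

instance rootedProduct_isFiniteMeasure (o : V) (x : E) (ν : Measure E) [IsFiniteMeasure ν] :
    IsFiniteMeasure (rootedProduct o x ν) := by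
  unfold rootedProduct; infer_instance

theorem rootedProduct_ne_zero (o : V) (x : E) (ν : Measure E) [SigmaFinite ν] (hν : ν ≠ 0) :
    rootedProduct o x ν ≠ 0 := by
  rw [← Measure.measure_univ_ne_zero, rootedProduct, Measure.pi_univ, Finset.prod_ne_zero_iff]
  intro v _
  split_ifs
  · simp
  · simpa using hν

theorem rootedProduct_ae_root [MeasurableSingletonClass E] (o : V) (x : E) (ν : Measure E)
    [SigmaFinite ν] : ∀ᵐ φ ∂(rootedProduct o x ν), φ o = x := by
  have h : ∀ᵐ y ∂(if o = o then Measure.dirac x else ν), y = x := by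
    rw [if_pos rfl]
    exact (ae_dirac_iff (p := fun y => y = x) (measurableSet_singleton x)).2 rfl
  exact (Measure.tendsto_eval_ae_ae
    (μ := fun v => if v = o then Measure.dirac x else ν) (i := o)).eventually h

end Rooted

section Model

variable {V : Type*} [Fintype V] [DecidableEq V] (G : SimpleGraph V) [DecidableRel G.Adj]

/-- The Hamiltonian `H(σ) = -∑_{{i,j} ∈ E} σ_i · σ_j` of the spin `O(N)` model. -/
def hamiltonian (N : ℕ) (σ : V → Spin N) : ℝ :=
  -∑ e ∈ G.edgeFinset,
    Sym2.lift ⟨fun i j => inner ℝ (σ i : EuclideanSpace ℝ (Fin N)) (σ j),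
      fun _ _ => real_inner_comm _ _⟩ e

/-- The Dirichlet energy `∑_{{i,j} ∈ E} ‖γ_i - γ_j‖²`. -/
def dirichletEnergy (d : ℕ) (γ : V → EuclideanSpace ℝ (Fin d)) : ℝ :=
  ∑ e ∈ G.edgeFinset,
    Sym2.lift ⟨fun i j => ‖γ i - γ j‖ ^ 2, fun i j => by simp only [norm_sub_rev (γ i) (γ j)]⟩ e

/-- The law of the spin `O(N)` model at inverse temperature `β` with `σ_o` rooted at the north
pole: the probability measure proportional to `exp (-β H(σ)) ∏_{v ≠ o} dσ_v` on the
configurations with `σ_o = (0, …, 0, 1)`. -/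
def rootedSpinMeasure (o : V) (N : ℕ) (hN : 0 < N) (β : ℝ) : Measure (V → Spin N) :=
  (rootedProduct o (northPole N hN) (surface N)).tilted fun σ => -β * hamiltonian G N σ

/-- The law of the `d`-component Gaussian free field with `γ_o` rooted at `0`: the probability
measure proportional to `exp (-½ ∑_{{i,j} ∈ E} ‖γ_i - γ_j‖²) ∏_{v ≠ o} dγ_v` on the fields
with `γ_o = 0`. -/
def rootedGFFMeasure (o : V) (d : ℕ) : Measure (V → EuclideanSpace ℝ (Fin d)) :=
  (rootedProduct o 0 volume).tilted fun γ => -(1 / 2) * dirichletEnergy G d γ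

theorem continuous_hamiltonian (N : ℕ) : Continuous (hamiltonian (V := V) G N) := by
  unfold hamiltonian
  refine (continuous_finsetSum _ fun e _ => ?_).neg
  induction e with
  | _ i j => simp only [Sym2.lift_mk]; fun_prop

theorem continuous_dirichletEnergy (d : ℕ) : Continuous (dirichletEnergy (V := V) G d) := by
  unfold dirichletEnergy
  refine continuous_finsetSum _ fun e _ => ?_
  induction e with
  | _ i j => simp only [Sym2.lift_mk]; fun_prop

theorem isProbabilityMeasure_rootedSpinMeasure (o : V) (N : ℕ) (hN : 0 < N) (β : ℝ) :
    IsProbabilityMeasure (rootedSpinMeasure G o N hN β) := by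
  have : Nonempty (Fin N) := ⟨⟨0, hN⟩⟩
  have : IsFiniteMeasure (surface N) := by unfold surface; infer_instance
  have hs : surface N ≠ 0 := Measure.toSphere_ne_zero _
  have : NeZero (rootedProduct o (northPole N hN) (surface N)) :=
    ⟨rootedProduct_ne_zero _ _ _ hs⟩
  refine isProbabilityMeasure_tilted ?_
  have hc : Continuous fun σ : V → Spin N => Real.exp (-β * hamiltonian G N σ) :=
    Real.continuous_exp.comp (continuous_const.mul (continuous_hamiltonian G N))
  exact hc.integrable_of_hasCompactSupport (HasCompactSupport.of_compactSpace _)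

theorem norm_sub_le_walk (d : ℕ) (γ : V → EuclideanSpace ℝ (Fin d)) {u v : V} (p : G.Walk u v) :
    ‖γ u - γ v‖ ≤ p.length * Real.sqrt (dirichletEnergy G d γ) := by
  induction p with
  | nil => simp
  | @cons a b c h p ih =>
    have h1 : ‖γ a - γ b‖ ≤ Real.sqrt (dirichletEnergy G d γ) := by
      apply Real.le_sqrt_of_sq_le
      have := Finset.single_le_sum (s := G.edgeFinset)
        (f := Sym2.lift ⟨fun i j => ‖γ i - γ j‖ ^ 2,
          fun i j => by simp only [norm_sub_rev (γ i) (γ j)]⟩)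
        (fun e _ => by induction e with | _ i j => simp only [Sym2.lift_mk]; positivity)
        (a := s(a, b)) (by simpa using h)
      simpa [dirichletEnergy] using this
    have h2 : ‖γ a - γ c‖ ≤ ‖γ a - γ b‖ + ‖γ b - γ c‖ := norm_sub_le_norm_sub_add_norm_sub _ _ _
    simp only [SimpleGraph.Walk.length_cons]
    push_cast
    linarith

theorem dirichletEnergy_nonneg (d : ℕ) (γ : V → EuclideanSpace ℝ (Fin d)) :
    0 ≤ dirichletEnergy G d γ :=
  Finset.sum_nonneg fun e _ => by
    induction e with | _ i j => simp only [Sym2.lift_mk]; positivity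

theorem exists_coercive (hG : G.Connected) (o : V) (d : ℕ) :
    ∃ c : ℝ, 0 < c ∧ ∀ γ : V → EuclideanSpace ℝ (Fin d), γ o = 0 →
      c * ∑ v, ‖γ v‖ ^ 2 ≤ dirichletEnergy G d γ := by
  let p : ∀ v, G.Walk v o := fun v => (hG.preconnected v o).some
  let K : ℝ := ∑ v, ((p v).length : ℝ) ^ 2
  have hK : 0 ≤ K := Finset.sum_nonneg fun v _ => by positivity
  refine ⟨(K + 1)⁻¹, by positivity, fun γ h0 => ?_⟩
  have h1 : ∑ v, ‖γ v‖ ^ 2 ≤ K * dirichletEnergy G d γ := by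
    rw [Finset.sum_mul]
    refine Finset.sum_le_sum fun v _ => ?_
    have := norm_sub_le_walk G d γ (p v)
    rw [h0, sub_zero] at this
    calc ‖γ v‖ ^ 2 ≤ ((p v).length * Real.sqrt (dirichletEnergy G d γ)) ^ 2 := by gcongr
      _ = _ := by rw [mul_pow, Real.sq_sqrt (dirichletEnergy_nonneg G d γ)]
  rw [inv_mul_le_iff₀ (by positivity)]
  linarith [dirichletEnergy_nonneg G d γ]

theorem integrable_gaussian (d : ℕ) {b : ℝ} (hb : 0 < b) :
    Integrable (fun x : EuclideanSpace ℝ (Fin d) => Real.exp (-b * ‖x‖ ^ 2)) := by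
  have h := (GaussianFourier.integrable_cexp_neg_mul_sq_norm_add (V := EuclideanSpace ℝ (Fin d))
    (b := (b : ℂ)) (by simpa using hb) 0 0).norm
  refine h.congr (Eventually.of_forall fun x => ?_)
  simp [Complex.norm_exp, ← Complex.ofReal_pow]

theorem isProbabilityMeasure_rootedGFFMeasure (hG : G.Connected) (o : V) (d : ℕ) :
    IsProbabilityMeasure (rootedGFFMeasure G o d) := by
  have : NeZero (rootedProduct o (0 : EuclideanSpace ℝ (Fin d)) volume) :=
    ⟨rootedProduct_ne_zero _ _ _ (NeZero.ne _)⟩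
  refine isProbabilityMeasure_tilted ?_
  obtain ⟨c, hc, h⟩ := exists_coercive G hG o d
  have hi : Integrable (fun γ : V → EuclideanSpace ℝ (Fin d) =>
      ∏ v, Real.exp (-(c / 2) * ‖γ v‖ ^ 2)) (rootedProduct o 0 volume) := by
    refine Integrable.fintype_prod
      (f := fun _ (x : EuclideanSpace ℝ (Fin d)) => Real.exp (-(c / 2) * ‖x‖ ^ 2)) fun v => ?_
    split_ifs
    · exact integrable_dirac (by simp)
    · exact integrable_gaussian d (by positivity)
  refine hi.mono' ?_ ?_
  · exact (Real.continuous_exp.comp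
      (continuous_const.mul (continuous_dirichletEnergy G d))).aestronglyMeasurable
  · filter_upwards [rootedProduct_ae_root o (0 : EuclideanSpace ℝ (Fin d)) volume] with γ h0
    rw [Real.norm_eq_abs, Real.abs_exp, ← Real.exp_sum, Real.exp_le_exp, ← Finset.mul_sum]
    linarith [h γ h0]

/-- The law of the rooted spin `O(N)` model, as a bundled probability measure. -/
def rootedSpinLaw (o : V) (N : ℕ) (hN : 0 < N) (β : ℝ) : ProbabilityMeasure (V → Spin N) :=
  ⟨rootedSpinMeasure G o N hN β, isProbabilityMeasure_rootedSpinMeasure G o N hN β⟩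

/-- The law of the rooted Gaussian free field on a connected graph, as a bundled probability
measure. -/
def rootedGFFLaw (hG : G.Connected) (o : V) (d : ℕ) :
    ProbabilityMeasure (V → EuclideanSpace ℝ (Fin d)) :=
  ⟨rootedGFFMeasure G o d, isProbabilityMeasure_rootedGFFMeasure G hG o d⟩

end Model

/-- The rescaled field `(√β σ¹, …, √β σ^{N-1})`: the first `N - 1` coordinates of `√β σ`. -/
def rescaledField {V : Type*} (N : ℕ) (β : ℝ) (σ : V → Spin N) :
    V → EuclideanSpace ℝ (Fin (N - 1)) :=
  fun v => WithLp.toLp 2 fun k : Fin (N - 1) =>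
    Real.sqrt β * (σ v : EuclideanSpace ℝ (Fin N)) (Fin.castLE (Nat.sub_le N 1) k)

end SpinON

end

noncomputable section

namespace SpinON

open scoped ENNReal Topology Pointwise

/-! Put `N = d + 1` and `β = r ^ 2`. Since `‖σ_i - σ_j‖² = 2 - 2 σ_i · σ_j` on the sphere, the Gibbs
weight is a constant times `exp (-(r ^ 2 / 2) * spinEnergy)`, and large `r` forces all spins towards
the root spin, the north pole. Near the pole each spin is written as `gnomonic (r⁻¹ • w v)`. In this
chart the surface measure, multiplied by `r ^ d`, is Lebesgue measure with a density that is at most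
`1` and tends to `1` (`smul_surface_restrict_upperHemisphere`), while the exponent tends pointwise
to `-(1/2)` times the Dirichlet energy of `w` (`tendsto_sq_mul_spinEnergy_chart`).

Connectedness makes the energy coercive. When all spins lie in `cap`, this gives a Gaussian bound in
`w`, hence dominated convergence (`tendsto_integral_chart_cap`). Off `cap` the energy is bounded
below, so the exponential beats every power of `r` (`tendsto_integral_compl_cap`). Expectations of
bounded continuous functions are quotients of two such integrals, in which the power of `r` and the
constant weight cancel. -/

/-! ### The gnomonic chart -/

/-- The point `(y, t)` of `ℝ^{d+1}`. -/
def snocPoint (d : ℕ) (y : EuclideanSpace ℝ (Fin d)) (t : ℝ) : EuclideanSpace ℝ (Fin (d + 1)) :=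
  WithLp.toLp 2 (Fin.snoc (α := fun _ => ℝ) y t)

@[simp]
theorem snocPoint_castSucc (d : ℕ) (y : EuclideanSpace ℝ (Fin d)) (t : ℝ) (k : Fin d) :
    snocPoint d y t k.castSucc = y k := by
  simp [snocPoint]

@[simp]
theorem snocPoint_last (d : ℕ) (y : EuclideanSpace ℝ (Fin d)) (t : ℝ) :
    snocPoint d y t (Fin.last d) = t := by
  simp [snocPoint]

theorem norm_snocPoint_sq (d : ℕ) (y : EuclideanSpace ℝ (Fin d)) (t : ℝ) :
    ‖snocPoint d y t‖ ^ 2 = ‖y‖ ^ 2 + t ^ 2 := by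
  simp [EuclideanSpace.norm_sq_eq, Fin.sum_univ_castSucc]

theorem snocPoint_smul (d : ℕ) (c : ℝ) (y : EuclideanSpace ℝ (Fin d)) (t : ℝ) :
    snocPoint d (c • y) (c * t) = c • snocPoint d y t := by
  ext k
  refine Fin.lastCases ?_ (fun k => ?_) k <;> simp

theorem snocPoint_sub (d : ℕ) (y z : EuclideanSpace ℝ (Fin d)) (s t : ℝ) :
    snocPoint d y s - snocPoint d z t = snocPoint d (y - z) (s - t) := by
  ext k
  refine Fin.lastCases ?_ (fun k => ?_) k <;> simp

theorem snocPoint_eta {d : ℕ} (x : EuclideanSpace ℝ (Fin (d + 1))) :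
    snocPoint d (WithLp.toLp 2 fun k : Fin d => x k.castSucc) (x (Fin.last d)) = x := by
  ext k
  refine Fin.lastCases ?_ (fun k => ?_) k <;> simp

theorem measurePreserving_snocPoint (d : ℕ) :
    MeasurePreserving (fun p : ℝ × EuclideanSpace ℝ (Fin d) => snocPoint d p.2 p.1) := by
  have h1 : MeasurePreserving
      (Prod.map id WithLp.ofLp : ℝ × EuclideanSpace ℝ (Fin d) → ℝ × (Fin d → ℝ)) :=
    (MeasurePreserving.id volume).prod (PiLp.volume_preserving_ofLp (Fin d))
  have h2 := (volume_preserving_piFinSuccAbove (fun _ : Fin (d + 1) => ℝ) (Fin.last d)).symm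
  have h3 := PiLp.volume_preserving_toLp (Fin (d + 1))
  have h := h3.comp (h2.comp h1)
  convert h using 1
  ext p k
  refine Fin.lastCases ?_ (fun k => ?_) k <;>
    simp [MeasurableEquiv.piFinSuccAbove, Fin.insertNthEquiv]

/-- The last coordinate of the image of `y` under the gnomonic chart. -/
def gnomonicHeight {d : ℕ} (y : EuclideanSpace ℝ (Fin d)) : ℝ := (Real.sqrt (1 + ‖y‖ ^ 2))⁻¹

theorem gnomonicHeight_pos {d : ℕ} (y : EuclideanSpace ℝ (Fin d)) : 0 < gnomonicHeight y := by
  unfold gnomonicHeight; positivity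

theorem gnomonicHeight_sq {d : ℕ} (y : EuclideanSpace ℝ (Fin d)) :
    gnomonicHeight y ^ 2 * (1 + ‖y‖ ^ 2) = 1 := by
  unfold gnomonicHeight
  rw [inv_pow, Real.sq_sqrt (by positivity)]
  exact inv_mul_cancel₀ (by positivity)

theorem gnomonicHeight_le_one {d : ℕ} (y : EuclideanSpace ℝ (Fin d)) : gnomonicHeight y ≤ 1 := by
  have h1 := gnomonicHeight_sq y
  have h2 := gnomonicHeight_pos y
  nlinarith [mul_nonneg (sq_nonneg (gnomonicHeight y)) (sq_nonneg ‖y‖)]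

theorem continuous_gnomonicHeight (d : ℕ) :
    Continuous (gnomonicHeight : EuclideanSpace ℝ (Fin d) → ℝ) := by
  unfold gnomonicHeight
  refine Continuous.inv₀ (by fun_prop) fun y => by positivity

/-- The inverse gnomonic chart of the upper hemisphere: `y ↦ (y, 1) / √(1 + ‖y‖²)`. -/
def gnomonic {d : ℕ} (y : EuclideanSpace ℝ (Fin d)) : Spin (d + 1) :=
  ⟨gnomonicHeight y • snocPoint d y 1, by
    have h : ‖gnomonicHeight y • snocPoint d y 1‖ ^ 2 = 1 := by
      rw [norm_smul, mul_pow, norm_snocPoint_sq, Real.norm_eq_abs, sq_abs, one_pow, add_comm]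
      exact gnomonicHeight_sq y
    rw [mem_sphere_zero_iff_norm]
    exact (pow_eq_one_iff_of_nonneg (norm_nonneg _) two_ne_zero).1 h⟩

theorem coe_gnomonic {d : ℕ} (y : EuclideanSpace ℝ (Fin d)) :
    (gnomonic y : EuclideanSpace ℝ (Fin (d + 1))) = gnomonicHeight y • snocPoint d y 1 := rfl

theorem gnomonic_last {d : ℕ} (y : EuclideanSpace ℝ (Fin d)) :
    (gnomonic y : EuclideanSpace ℝ (Fin (d + 1))) (Fin.last d) = gnomonicHeight y := by
  simp [coe_gnomonic]

theorem gnomonic_castSucc {d : ℕ} (y : EuclideanSpace ℝ (Fin d)) (k : Fin d) :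
    (gnomonic y : EuclideanSpace ℝ (Fin (d + 1))) k.castSucc = gnomonicHeight y * y k := by
  simp [coe_gnomonic]

theorem gnomonic_zero (d : ℕ) :
    gnomonic (0 : EuclideanSpace ℝ (Fin d)) = northPole (d + 1) (Nat.succ_pos d) := by
  ext k
  refine Fin.lastCases ?_ (fun k => ?_) k
  · rw [gnomonic_last]
    simp [gnomonicHeight, northPole, Fin.last]
  · rw [gnomonic_castSucc]
    simp [northPole, Fin.ext_iff, k.2.ne]

theorem continuous_snocPoint (d : ℕ) :
    Continuous (fun p : EuclideanSpace ℝ (Fin d) × ℝ => snocPoint d p.1 p.2) := by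
  unfold snocPoint
  refine (PiLp.continuous_toLp 2 _).comp (continuous_pi fun k => ?_)
  refine Fin.lastCases ?_ (fun k => ?_) k
  · simpa using continuous_snd
  · simp only [Fin.snoc_castSucc]; fun_prop

theorem continuous_gnomonic (d : ℕ) :
    Continuous (gnomonic : EuclideanSpace ℝ (Fin d) → Spin (d + 1)) := by
  refine Continuous.subtype_mk ?_ _
  exact (continuous_gnomonicHeight d).smul
    ((continuous_snocPoint d).comp (continuous_id.prodMk continuous_const))

/-! ### Surface measure in the gnomonic chart -/

/-- The open upper hemisphere. -/
def upperHemisphere (d : ℕ) : Set (Spin (d + 1)) :=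
  {σ | 0 < (σ : EuclideanSpace ℝ (Fin (d + 1))) (Fin.last d)}

theorem measurableSet_upperHemisphere (d : ℕ) : MeasurableSet (upperHemisphere d) :=
  (isOpen_lt continuous_const (by fun_prop)).measurableSet

/-- The chart inverts central projection to the plane at height `1`, so it sees only the ray through
a point. -/
theorem gnomonic_inv_smul_of_snocPoint {d : ℕ} {z : EuclideanSpace ℝ (Fin d)} {t : ℝ} (ht : 0 < t)
    {σ : Spin (d + 1)} {r : ℝ} (hr : 0 < r)
    (h : snocPoint d z t = r • (σ : EuclideanSpace ℝ (Fin (d + 1)))) :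
    gnomonic (t⁻¹ • z) = σ := by
  have h1 : snocPoint d (t⁻¹ • z) 1 = (t⁻¹ * r) • (σ : EuclideanSpace ℝ (Fin (d + 1))) := by
    rw [mul_smul, ← h, ← snocPoint_smul, inv_mul_cancel₀ ht.ne']
  have h2 : ‖snocPoint d (t⁻¹ • z) 1‖ = t⁻¹ * r := by
    rw [h1, norm_smul, norm_eq_of_mem_sphere, mul_one, Real.norm_eq_abs, abs_of_pos (by positivity)]
  have h3 := norm_snocPoint_sq d (t⁻¹ • z) 1
  apply Subtype.ext
  rw [coe_gnomonic, gnomonicHeight, h1, smul_smul, add_comm 1 (_ ^ 2)]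
  rw [one_pow] at h3
  rw [← h3, Real.sqrt_sq (norm_nonneg _), h2, inv_mul_cancel₀ (by positivity), one_smul]

/-- A point at height `t > 0` in direction `gnomonic (t⁻¹ • z)` has norm `t / gnomonicHeight (t⁻¹ •
z)`. Cones matter because `Measure.toSphere` is defined by their volume. -/
theorem snocPoint_mem_cone_iff {d : ℕ} {S : Set (Spin (d + 1))} (hS : S ⊆ upperHemisphere d)
    (z : EuclideanSpace ℝ (Fin d)) (t : ℝ) :
    snocPoint d z t ∈ Set.Ioo (0 : ℝ) 1 • (Subtype.val '' S) ↔
      0 < t ∧ t < gnomonicHeight (t⁻¹ • z) ∧ gnomonic (t⁻¹ • z) ∈ S := by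
  constructor
  · rintro ⟨r, hr, _, ⟨σ, hσ, rfl⟩, h⟩
    have hr0 : 0 < r := hr.1
    have h : snocPoint d z t = r • (σ : EuclideanSpace ℝ (Fin (d + 1))) := h.symm
    have ht' : t = r * (σ : EuclideanSpace ℝ (Fin (d + 1))) (Fin.last d) := by
      rw [← snocPoint_last d z t, h]; simp
    have hσ0 : 0 < (σ : EuclideanSpace ℝ (Fin (d + 1))) (Fin.last d) := hS hσ
    have ht : 0 < t := by rw [ht']; positivity
    have hg := gnomonic_inv_smul_of_snocPoint ht hr0 h
    refine ⟨ht, ?_, hg ▸ hσ⟩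
    rw [← gnomonic_last, hg]
    nlinarith [hr.2]
  · rintro ⟨ht, ht1, hg⟩
    have ha := gnomonicHeight_pos (t⁻¹ • z)
    refine ⟨t / gnomonicHeight (t⁻¹ • z), ⟨by positivity, (div_lt_one ha).2 ht1⟩, _,
      ⟨_, hg, rfl⟩, ?_⟩
    simp only [coe_gnomonic]
    rw [smul_smul, div_mul_cancel₀ _ ha.ne', ← snocPoint_smul, smul_smul, mul_inv_cancel₀ ht.ne',
      one_smul, mul_one]

theorem measurableSet_cone {d : ℕ} {S : Set (Spin (d + 1))} (hS : S ⊆ upperHemisphere d)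
    (hm : MeasurableSet S) :
    MeasurableSet (Set.Ioo (0 : ℝ) 1 • ((Subtype.val : Spin (d + 1) → _) '' S)) := by
  have hlast : Measurable fun x : EuclideanSpace ℝ (Fin (d + 1)) => x (Fin.last d) := by fun_prop
  let init : EuclideanSpace ℝ (Fin (d + 1)) → EuclideanSpace ℝ (Fin d) :=
    fun x => (x (Fin.last d))⁻¹ • WithLp.toLp 2 fun k : Fin d => x k.castSucc
  have hinit : Measurable init := by
    refine Measurable.smul hlast.inv ?_
    exact (Continuous.measurable (by fun_prop))
  have : Set.Ioo (0 : ℝ) 1 • ((Subtype.val : Spin (d + 1) → _) '' S) =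
      {x | 0 < x (Fin.last d)} ∩ ({x | x (Fin.last d) < gnomonicHeight (init x)} ∩
        {x | gnomonic (init x) ∈ S}) := by
    ext x
    conv_lhs => rw [← snocPoint_eta x]
    rw [snocPoint_mem_cone_iff hS]
    rfl
  rw [this]
  refine (measurableSet_lt measurable_const hlast).inter
    ((measurableSet_lt hlast ((continuous_gnomonicHeight d).measurable.comp hinit)).inter
      (((continuous_gnomonic d).measurable.comp hinit) hm))

theorem lintegral_Ioo_pow (d : ℕ) {a : ℝ} (ha : 0 < a) :
    ∫⁻ t in Set.Ioo 0 a, ENNReal.ofReal (t ^ d) = ENNReal.ofReal (a ^ (d + 1) / (d + 1)) := by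
  rw [← ofReal_integral_eq_lintegral_ofReal]
  · rw [← integral_Ioc_eq_integral_Ioo, ← intervalIntegral.integral_of_le ha.le, integral_pow]
    simp
  · exact ((continuous_pow d).integrableOn_Icc (a := 0) (b := a)).mono_set Set.Ioo_subset_Icc_self
  · filter_upwards [self_mem_ae_restrict measurableSet_Ioo] with t ht
    exact pow_nonneg ht.1.le _

/-- The area of `S` is `d + 1` times the volume of its cone. Slicing the cone at height `t` and
substituting `z = t • y` gives the Jacobian `t ^ d`; integrating over `0 < t < gnomonicHeight y`
yields `gnomonicHeight y ^ (d + 1) / (d + 1)`, and the factor `d + 1` cancels. -/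
theorem surface_apply_of_subset_upperHemisphere {d : ℕ} {S : Set (Spin (d + 1))}
    (hS : S ⊆ upperHemisphere d) (hm : MeasurableSet S) :
    surface (d + 1) S =
      ∫⁻ y in gnomonic ⁻¹' S, ENNReal.ofReal (gnomonicHeight y ^ (d + 1)) := by
  have hmg : MeasurableSet ((gnomonic : EuclideanSpace ℝ (Fin d) → _) ⁻¹' S) :=
    (continuous_gnomonic d).measurable hm
  let F : ℝ → EuclideanSpace ℝ (Fin d) → ℝ≥0∞ := fun t y =>
    {p : ℝ × EuclideanSpace ℝ (Fin d) | 0 < p.1 ∧ p.1 < gnomonicHeight p.2 ∧ gnomonic p.2 ∈ S}.indicator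
      (fun p => ENNReal.ofReal (p.1 ^ d)) (t, y)
  have hmF : Measurable (Function.uncurry F) := by
    refine Measurable.indicator (by fun_prop) ?_
    refine (measurableSet_lt measurable_const measurable_fst).inter
      ((measurableSet_lt measurable_fst
        ((continuous_gnomonicHeight d).measurable.comp measurable_snd)).inter ?_)
    exact measurable_snd hmg
  have hslice : ∀ t : ℝ, volume (Prod.mk t ⁻¹' ((fun p : ℝ × EuclideanSpace ℝ (Fin d) =>
      snocPoint d p.2 p.1) ⁻¹' (Set.Ioo (0 : ℝ) 1 • (Subtype.val '' S)))) = ∫⁻ y, F t y := by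
    intro t
    have hset : Prod.mk t ⁻¹' ((fun p : ℝ × EuclideanSpace ℝ (Fin d) =>
        snocPoint d p.2 p.1) ⁻¹' (Set.Ioo (0 : ℝ) 1 • (Subtype.val '' S))) =
        {z | 0 < t ∧ t < gnomonicHeight (t⁻¹ • z) ∧ gnomonic (t⁻¹ • z) ∈ S} := by
      ext z
      exact snocPoint_mem_cone_iff hS z t
    rw [hset]
    by_cases ht : 0 < t
    · let B : Set (EuclideanSpace ℝ (Fin d)) := {y | t < gnomonicHeight y ∧ gnomonic y ∈ S}
      have hB : MeasurableSet B :=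
        (measurableSet_lt measurable_const (continuous_gnomonicHeight d).measurable).inter hmg
      have h1 : {z : EuclideanSpace ℝ (Fin d) |
          0 < t ∧ t < gnomonicHeight (t⁻¹ • z) ∧ gnomonic (t⁻¹ • z) ∈ S} =
          (fun z => t⁻¹ • z) ⁻¹' B := by
        ext z; simp [B, ht]
      have h2 : F t = B.indicator fun _ => ENNReal.ofReal (t ^ d) := by
        ext y
        by_cases hy : y ∈ B
        · rw [Set.indicator_of_mem hy]
          exact Set.indicator_of_mem (by exact ⟨ht, hy⟩) _
        · rw [Set.indicator_of_notMem hy]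
          exact Set.indicator_of_notMem (fun h => hy h.2) _
      rw [h1, Measure.addHaar_preimage_smul _ (inv_ne_zero ht.ne'), h2, lintegral_indicator hB,
        setLIntegral_const]
      simp [abs_of_pos ht]
    · have h2 : F t = 0 := by
        ext y; simp [F, ht]
      simp [ht, h2]
  have hswap : ∀ y : EuclideanSpace ℝ (Fin d), ∫⁻ t, F t y =
      (gnomonic ⁻¹' S).indicator
        (fun y => ENNReal.ofReal (gnomonicHeight y ^ (d + 1) / (d + 1))) y := by
    intro y
    by_cases hy : gnomonic y ∈ S
    · have h1 : (fun t => F t y) =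
          (Set.Ioo 0 (gnomonicHeight y)).indicator fun t => ENNReal.ofReal (t ^ d) := by
        ext t
        by_cases ht : t ∈ Set.Ioo 0 (gnomonicHeight y)
        · rw [Set.indicator_of_mem ht]
          exact Set.indicator_of_mem (by exact ⟨ht.1, ht.2, hy⟩) _
        · rw [Set.indicator_of_notMem ht]
          exact Set.indicator_of_notMem (fun h => ht ⟨h.1, h.2.1⟩) _
      rw [h1, lintegral_indicator measurableSet_Ioo, lintegral_Ioo_pow d (gnomonicHeight_pos y),
        Set.indicator_of_mem (by exact hy)]
    · have h1 : (fun t => F t y) = 0 := by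
        ext t; simp [F, hy]
      rw [h1, Set.indicator_of_notMem (by exact hy)]
      exact lintegral_zero
  rw [surface, Measure.toSphere_apply' _ hm, finrank_euclideanSpace_fin,
    ← (measurePreserving_snocPoint d).measure_preimage (measurableSet_cone hS hm).nullMeasurableSet,
    Measure.volume_eq_prod, Measure.prod_apply
      ((measurePreserving_snocPoint d).measurable (measurableSet_cone hS hm)),
    lintegral_congr hslice, lintegral_lintegral_swap hmF.aemeasurable, lintegral_congr hswap,
    lintegral_indicator hmg, ← lintegral_const_mul]
  · refine lintegral_congr fun y => ?_
    rw [← ENNReal.ofReal_natCast, ← ENNReal.ofReal_mul (by positivity)]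
    congr 1
    push_cast
    field_simp
  · exact ((((continuous_gnomonicHeight d).pow _).div_const _).measurable).ennreal_ofReal

theorem gnomonic_mem_upperHemisphere {d : ℕ} (y : EuclideanSpace ℝ (Fin d)) :
    gnomonic y ∈ upperHemisphere d := by
  change 0 < (gnomonic y : EuclideanSpace ℝ (Fin (d + 1))) (Fin.last d)
  rw [gnomonic_last]
  exact gnomonicHeight_pos y

/-- The surface measure on the upper hemisphere in the rescaled gnomonic chart. -/
theorem smul_surface_restrict_upperHemisphere (d : ℕ) {r : ℝ} (hr : 0 < r) :
    ENNReal.ofReal (r ^ d) • (surface (d + 1)).restrict (upperHemisphere d) =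
      (volume.withDensity fun w : EuclideanSpace ℝ (Fin d) =>
        ENNReal.ofReal (gnomonicHeight (r⁻¹ • w) ^ (d + 1))).map fun w => gnomonic (r⁻¹ • w) := by
  have hs : Measurable fun w : EuclideanSpace ℝ (Fin d) => r⁻¹ • w := measurable_const_smul _
  have hg := (continuous_gnomonic d).measurable
  ext S hm
  have hmS := hm.inter (measurableSet_upperHemisphere d)
  have hpre : (gnomonic : EuclideanSpace ℝ (Fin d) → _) ⁻¹' (S ∩ upperHemisphere d) =
      gnomonic ⁻¹' S := by
    ext y; simp [gnomonic_mem_upperHemisphere]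
  rw [Measure.smul_apply, Measure.restrict_apply hm,
    surface_apply_of_subset_upperHemisphere Set.inter_subset_right hmS, hpre,
    Measure.map_apply (show Measurable fun w => gnomonic (r⁻¹ • w) from hg.comp hs) hm,
    withDensity_apply _ (show MeasurableSet ((fun w => gnomonic (r⁻¹ • w)) ⁻¹' S) from
      (hg.comp hs) hm)]
  -- The factor `r ^ d` is the Jacobian of the substitution `w = r • y`.
  have h1 := Measure.map_addHaar_smul (volume : Measure (EuclideanSpace ℝ (Fin d)))
    (inv_ne_zero hr.ne')
  rw [finrank_euclideanSpace_fin, inv_pow, inv_inv, abs_of_pos (by positivity)] at h1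
  rw [← lintegral_smul_measure, ← Measure.restrict_smul, ← h1, setLIntegral_map (hg hm) _ hs]
  · rfl
  · exact ((continuous_gnomonicHeight d).pow _).measurable.ennreal_ofReal

/-! ### Finite products of scaled and weighted measures -/

section Pi

variable {ι : Type*} [Fintype ι] {α : ι → Type*} {mα : ∀ i, MeasurableSpace (α i)}

theorem pi_const_smul (μ : ∀ i, Measure (α i)) [∀ i, SigmaFinite (μ i)] (c : ι → ℝ≥0∞)
    [∀ i, SigmaFinite (c i • μ i)] :
    Measure.pi (fun i => c i • μ i) = (∏ i, c i) • Measure.pi μ := by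
  refine Measure.pi_eq fun s _ => ?_
  simp [Measure.pi_pi, Finset.prod_mul_distrib]

/-- It suffices to test on boxes, where indicator times density is a product of one-variable
functions. Real integrable densities allow the Bochner product formula to factor the integral. -/
theorem pi_withDensity_ofReal (μ : ∀ i, Measure (α i)) [∀ i, SigmaFinite (μ i)]
    (f : ∀ i, α i → ℝ) (hf : ∀ i, Integrable (f i) (μ i)) (h0 : ∀ i x, 0 ≤ f i x)
    [∀ i, SigmaFinite ((μ i).withDensity fun x => ENNReal.ofReal (f i x))] :
    Measure.pi (fun i => (μ i).withDensity fun x => ENNReal.ofReal (f i x)) =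
      (Measure.pi μ).withDensity fun x => ENNReal.ofReal (∏ i, f i (x i)) := by
  refine Measure.pi_eq fun s hs => ?_
  have h1 : ∀ x : ∀ i, α i, (Set.univ.pi s).indicator
      (fun x => ENNReal.ofReal (∏ i, f i (x i))) x =
        ENNReal.ofReal (∏ i, (s i).indicator (f i) (x i)) := by
    intro x
    by_cases hx : x ∈ Set.univ.pi s
    · rw [Set.indicator_of_mem hx]
      congr 1
      exact Finset.prod_congr rfl fun i _ => (Set.indicator_of_mem (hx i (Set.mem_univ i)) _).symm
    · obtain ⟨i, hi⟩ : ∃ i, x i ∉ s i := by simpa [Set.mem_univ_pi] using hx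
      rw [Set.indicator_of_notMem hx,
        Finset.prod_eq_zero (Finset.mem_univ i) (Set.indicator_of_notMem hi _), ENNReal.ofReal_zero]
  have hind : ∀ i, Integrable ((s i).indicator (f i)) (μ i) := fun i => (hf i).indicator (hs i)
  have h0' : ∀ i x, 0 ≤ (s i).indicator (f i) x :=
    fun i x => Set.indicator_nonneg (fun x _ => h0 i x) x
  rw [withDensity_apply _ (MeasurableSet.univ_pi hs),
    ← lintegral_indicator (MeasurableSet.univ_pi hs), lintegral_congr h1,
    ← ofReal_integral_eq_lintegral_ofReal (Integrable.fintype_prod_dep hind)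
      (Eventually.of_forall fun x => Finset.prod_nonneg fun i _ => h0' i _),
    integral_fintype_prod_eq_prod,
    ENNReal.ofReal_prod_of_nonneg fun i _ => integral_nonneg (h0' i)]
  refine Finset.prod_congr rfl fun i _ => ?_
  rw [ofReal_integral_eq_lintegral_ofReal (hind i) (Eventually.of_forall (h0' i)),
    withDensity_apply _ (hs i), ← lintegral_indicator (hs i)]
  refine lintegral_congr fun x => ?_
  by_cases hx : x ∈ s i <;> simp [hx]

end Pi

/-! ### The rooted product measure in the chart -/

instance isFiniteMeasure_surface (N : ℕ) : IsFiniteMeasure (surface N) := by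
  unfold surface; infer_instance

/-- The density of the surface measure in the rescaled gnomonic chart. -/
def chartDensity {d : ℕ} (r : ℝ) (w : EuclideanSpace ℝ (Fin d)) : ℝ :=
  gnomonicHeight (r⁻¹ • w) ^ (d + 1)

theorem continuous_chartDensity (d : ℕ) (r : ℝ) :
    Continuous (chartDensity r : EuclideanSpace ℝ (Fin d) → ℝ) :=
  ((continuous_gnomonicHeight d).comp (continuous_const_smul _)).pow _

theorem chartDensity_nonneg {d : ℕ} (r : ℝ) (w : EuclideanSpace ℝ (Fin d)) :
    0 ≤ chartDensity r w :=
  pow_nonneg (gnomonicHeight_pos _).le _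

theorem chartDensity_le_one {d : ℕ} (r : ℝ) (w : EuclideanSpace ℝ (Fin d)) :
    chartDensity r w ≤ 1 :=
  pow_le_one₀ (gnomonicHeight_pos _).le (gnomonicHeight_le_one _)

/-- The total integral is `r ^ d` times the area of the hemisphere. -/
theorem integrable_chartDensity (d : ℕ) {r : ℝ} (hr : 0 < r) :
    Integrable (chartDensity r : EuclideanSpace ℝ (Fin d) → ℝ) := by
  refine ⟨(continuous_chartDensity d r).aestronglyMeasurable, ?_⟩
  have h := congrArg (fun μ => μ Set.univ) (smul_surface_restrict_upperHemisphere d hr)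
  have hm : Measurable fun w : EuclideanSpace ℝ (Fin d) => gnomonic (r⁻¹ • w) :=
    ((continuous_gnomonic d).comp (continuous_const_smul _)).measurable
  simp only [Measure.map_apply hm MeasurableSet.univ, Set.preimage_univ,
    withDensity_apply _ MeasurableSet.univ, Measure.restrict_univ, Measure.smul_apply,
    smul_eq_mul] at h
  rw [hasFiniteIntegral_iff_ofReal (Eventually.of_forall fun w => chartDensity_nonneg r w)]
  unfold chartDensity
  rw [← h]
  exact ENNReal.mul_lt_top ENNReal.ofReal_lt_top (measure_lt_top _ _)

section Chart

variable {V : Type*} [Fintype V] [DecidableEq V]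

/-- Fields in the rescaled gnomonic chart. -/
def chart {d : ℕ} (r : ℝ) (w : V → EuclideanSpace ℝ (Fin d)) : V → Spin (d + 1) :=
  fun v => gnomonic (r⁻¹ • w v)

theorem continuous_chart (d : ℕ) (r : ℝ) :
    Continuous (chart r : (V → EuclideanSpace ℝ (Fin d)) → V → Spin (d + 1)) := by
  exact continuous_pi fun v =>
    ((continuous_gnomonic d).comp (continuous_const_smul r⁻¹)).comp (continuous_apply v)

/-- The identity holds factor by factor. At the root, the Dirac mass at the pole is the image of the
one at `0`, where the density is `1`; hence no power of `r` there. -/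
theorem smul_rootedProduct_restrict_upperHemisphere (o : V) (d : ℕ) {r : ℝ} (hr : 0 < r) :
    (∏ v : V, if v = o then 1 else ENNReal.ofReal (r ^ d)) •
        (rootedProduct o (northPole (d + 1) (Nat.succ_pos d)) (surface (d + 1))).restrict
          (Set.univ.pi fun _ : V => upperHemisphere d) =
      ((rootedProduct o (0 : EuclideanSpace ℝ (Fin d)) volume).withDensity fun w =>
        ENNReal.ofReal (∏ v, chartDensity r (w v))).map (chart r) := by
  have hm : Measurable fun w : EuclideanSpace ℝ (Fin d) => gnomonic (r⁻¹ • w) :=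
    ((continuous_gnomonic d).comp (continuous_const_smul _)).measurable
  have hint : ∀ v, Integrable (chartDensity r)
      (if v = o then Measure.dirac (0 : EuclideanSpace ℝ (Fin d)) else volume) := by
    intro v
    split_ifs
    · exact integrable_dirac (by simp)
    · exact integrable_chartDensity d hr
  have hfin : ∀ v, IsFiniteMeasure
      ((if v = o then Measure.dirac (0 : EuclideanSpace ℝ (Fin d)) else volume).withDensity
        fun w => ENNReal.ofReal (chartDensity r w)) := fun v =>
    isFiniteMeasure_withDensity_ofReal (hint v).2
  have hfin' : ∀ v : V, IsFiniteMeasure ((if v = o then 1 else ENNReal.ofReal (r ^ d)) •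
      (if v = o then Measure.dirac (northPole (d + 1) (Nat.succ_pos d))
        else surface (d + 1)).restrict (upperHemisphere d)) := by
    intro v
    refine Measure.smul_finite _ ?_
    split_ifs <;> simp
  unfold rootedProduct
  rw [Measure.restrict_pi_pi, ← pi_const_smul,
    ← pi_withDensity_ofReal _ (fun _ => chartDensity r) hint fun _ => chartDensity_nonneg r]
  unfold chart
  rw [Measure.pi_map_pi fun _ => hm.aemeasurable]
  congr 1
  ext1 v
  split_ifs
  · have h1 : northPole (d + 1) (Nat.succ_pos d) ∈ upperHemisphere d := by
      rw [← gnomonic_zero]; exact gnomonic_mem_upperHemisphere 0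
    have h2 : chartDensity r (0 : EuclideanSpace ℝ (Fin d)) = 1 := by
      simp [chartDensity, gnomonicHeight]
    classical
    rw [one_smul, restrict_dirac' (measurableSet_upperHemisphere d), if_pos h1,
      withDensity_congr_ae (g := 1) (by simp [Filter.EventuallyEq, h2]), withDensity_one,
      Measure.map_dirac' hm, smul_zero, gnomonic_zero]
  · exact smul_surface_restrict_upperHemisphere d hr

theorem integral_upperHemisphere_eq (o : V) (d : ℕ) {r : ℝ} (hr : 0 < r)
    {F : (V → Spin (d + 1)) → ℝ} (hF : Measurable F) :
    (∏ v : V, if v = o then 1 else r ^ d) *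
      ∫ σ in Set.univ.pi fun _ : V => upperHemisphere d, F σ
        ∂(rootedProduct o (northPole (d + 1) (Nat.succ_pos d)) (surface (d + 1))) =
      ∫ w, (∏ v, chartDensity r (w v)) * F (chart r w)
        ∂(rootedProduct o (0 : EuclideanSpace ℝ (Fin d)) volume) := by
  have hc : (∏ v : V, if v = o then 1 else r ^ d) =
      (∏ v : V, if v = o then 1 else ENNReal.ofReal (r ^ d)).toReal := by
    rw [ENNReal.toReal_prod]
    refine Finset.prod_congr rfl fun v _ => ?_
    split_ifs
    · simp
    · rw [ENNReal.toReal_ofReal (by positivity)]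
  have hdm : Measurable fun w : V → EuclideanSpace ℝ (Fin d) =>
      ENNReal.ofReal (∏ v, chartDensity r (w v)) := by
    refine (continuous_finsetProd _ fun v _ => ?_).measurable.ennreal_ofReal
    exact (continuous_chartDensity d r).comp (continuous_apply v)
  rw [hc, ← smul_eq_mul, ← integral_smul_measure,
    smul_rootedProduct_restrict_upperHemisphere o d hr,
    integral_map (continuous_chart d r).measurable.aemeasurable hF.aestronglyMeasurable,
    integral_withDensity_eq_integral_toReal_smul hdm
      (Eventually.of_forall fun _ => ENNReal.ofReal_lt_top)]
  refine integral_congr_ae (Eventually.of_forall fun w => ?_)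
  simp only [smul_eq_mul]
  rw [ENNReal.toReal_ofReal (Finset.prod_nonneg fun v _ => chartDensity_nonneg r _)]

end Chart

/-! ### Energy of spin configurations and its lower bounds -/

section Limit

variable {V : Type*} [Fintype V] [DecidableEq V] (G : SimpleGraph V) [DecidableRel G.Adj]

/-- The field `√β (σ¹, …, σ^{N-1})` with `N = d + 1` and `√β = r`. -/
def scaledProj {d : ℕ} (r : ℝ) (σ : V → Spin (d + 1)) : V → EuclideanSpace ℝ (Fin d) :=
  fun v => WithLp.toLp 2 fun k : Fin d =>
    r * (σ v : EuclideanSpace ℝ (Fin (d + 1))) k.castSucc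

theorem continuous_scaledProj (d : ℕ) (r : ℝ) :
    Continuous (scaledProj r : (V → Spin (d + 1)) → V → EuclideanSpace ℝ (Fin d)) := by
  unfold scaledProj
  fun_prop

theorem scaledProj_chart {d : ℕ} {r : ℝ} (hr : r ≠ 0) (w : V → EuclideanSpace ℝ (Fin d)) :
    scaledProj r (chart r w) = fun v => gnomonicHeight (r⁻¹ • w v) • w v := by
  ext v k
  simp only [scaledProj, chart, gnomonic_castSucc, PiLp.smul_apply, smul_eq_mul]
  field_simp

/-- The Dirichlet energy of a spin configuration. -/
def spinEnergy {N : ℕ} (σ : V → Spin N) : ℝ :=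
  dirichletEnergy G N fun v => (σ v : EuclideanSpace ℝ (Fin N))

theorem continuous_spinEnergy (N : ℕ) : Continuous (spinEnergy G : (V → Spin N) → ℝ) := by
  unfold spinEnergy
  exact (continuous_dirichletEnergy G N).comp (by fun_prop)

theorem neg_mul_hamiltonian (N : ℕ) (β : ℝ) (σ : V → Spin N) :
    -β * hamiltonian G N σ = β * G.edgeFinset.card + -(β / 2) * spinEnergy G σ := by
  have h : hamiltonian G N σ = -(G.edgeFinset.card : ℝ) + 1 / 2 * spinEnergy G σ := by
    have hc : (G.edgeFinset.card : ℝ) = ∑ _e ∈ G.edgeFinset, (1 : ℝ) := by simp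
    rw [hamiltonian, spinEnergy, dirichletEnergy, hc, Finset.mul_sum, ← Finset.sum_neg_distrib,
      ← Finset.sum_neg_distrib, ← Finset.sum_add_distrib]
    refine Finset.sum_congr rfl fun e _ => ?_
    induction e with
    | _ i j =>
      simp only [Sym2.lift_mk]
      rw [norm_sub_sq_real, norm_eq_of_mem_sphere, norm_eq_of_mem_sphere]
      ring
  rw [h]
  ring

/-- The Dirichlet energy is translation invariant, so the ambient field may be shifted by `σ o` to
vanish at the root. -/
theorem spinEnergy_coercive {G : SimpleGraph V} [DecidableRel G.Adj] (hG : G.Connected) (o : V)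
    (N : ℕ) : ∃ c : ℝ, 0 < c ∧ ∀ σ : V → Spin N,
      c * ∑ v, ‖(σ v : EuclideanSpace ℝ (Fin N)) - σ o‖ ^ 2 ≤ spinEnergy G σ := by
  obtain ⟨c, hc, h⟩ := exists_coercive G hG o N
  refine ⟨c, hc, fun σ => ?_⟩
  refine (h (fun v => (σ v : EuclideanSpace ℝ (Fin N)) - σ o) (sub_self _)).trans_eq ?_
  unfold spinEnergy dirichletEnergy
  refine Finset.sum_congr rfl fun e _ => ?_
  induction e with
  | _ i j => simp

theorem norm_sub_northPole_sq {d : ℕ} (σ : Spin (d + 1)) :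
    ‖(σ : EuclideanSpace ℝ (Fin (d + 1))) - northPole (d + 1) (Nat.succ_pos d)‖ ^ 2 =
      2 - 2 * (σ : EuclideanSpace ℝ (Fin (d + 1))) (Fin.last d) := by
  have h : inner ℝ (σ : EuclideanSpace ℝ (Fin (d + 1)))
      (northPole (d + 1) (Nat.succ_pos d) : EuclideanSpace ℝ (Fin (d + 1))) =
        (σ : EuclideanSpace ℝ (Fin (d + 1))) (Fin.last d) := by
    simp [northPole, EuclideanSpace.inner_single_right, Fin.last]
  rw [norm_sub_sq_real, norm_eq_of_mem_sphere, norm_eq_of_mem_sphere, h]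
  ring

/-- The configurations all of whose spins have last coordinate larger than `1/2`. -/
def cap (V : Type*) (d : ℕ) : Set (V → Spin (d + 1)) :=
  {σ | ∀ v, 1 / 2 < (σ v : EuclideanSpace ℝ (Fin (d + 1))) (Fin.last d)}

theorem measurableSet_cap (d : ℕ) : MeasurableSet (cap V d) := by
  have : cap V d =
      ⋂ v, {σ | 1 / 2 < (σ v : EuclideanSpace ℝ (Fin (d + 1))) (Fin.last d)} := by
    ext σ; simp [cap]
  rw [this]
  exact MeasurableSet.iInter fun v => (isOpen_lt continuous_const (by fun_prop)).measurableSet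

theorem le_spinEnergy_of_notMem_cap {d : ℕ} {o : V} {c : ℝ} (hc : 0 ≤ c) {σ : V → Spin (d + 1)}
    (h : c * ∑ v, ‖(σ v : EuclideanSpace ℝ (Fin (d + 1))) - σ o‖ ^ 2 ≤ spinEnergy G σ)
    (ho : σ o = northPole (d + 1) (Nat.succ_pos d)) (hσ : σ ∉ cap V d) :
    c ≤ spinEnergy G σ := by
  obtain ⟨v, hv⟩ : ∃ v, (σ v : EuclideanSpace ℝ (Fin (d + 1))) (Fin.last d) ≤ 1 / 2 := by
    simpa only [cap, Set.mem_ofPred_eq, not_forall, not_lt] using hσ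
  -- A spin of height at most `1/2` has squared distance at least `2 - 2 * (1/2) = 1` from the pole.
  have h1 : 1 ≤ ∑ v, ‖(σ v : EuclideanSpace ℝ (Fin (d + 1))) - σ o‖ ^ 2 := by
    refine le_trans ?_ (Finset.single_le_sum (fun v _ => by positivity) (Finset.mem_univ v))
    rw [ho, norm_sub_northPole_sq]
    linarith
  nlinarith

/-- This supplies the Gaussian domination. Distances on the sphere are bounded and chart coordinates
are not, so the comparison needs the restriction to `cap`. -/
theorem le_spinEnergy_chart {d : ℕ} {o : V} {c r : ℝ} (hc : 0 ≤ c) (hr : 0 < r)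
    {w : V → EuclideanSpace ℝ (Fin d)}
    (h : c * ∑ v, ‖(chart r w v : EuclideanSpace ℝ (Fin (d + 1))) - chart r w o‖ ^ 2 ≤
      spinEnergy G (chart r w))
    (ho : w o = 0) (hw : chart r w ∈ cap V d) :
    c / 4 * ∑ v, ‖w v‖ ^ 2 ≤ r ^ 2 * spinEnergy G (chart r w) := by
  refine le_trans ?_ (mul_le_mul_of_nonneg_left h (sq_nonneg r))
  have key : (1 / 4) * ∑ v, ‖w v‖ ^ 2 ≤
      r ^ 2 * ∑ v, ‖(chart r w v : EuclideanSpace ℝ (Fin (d + 1))) - chart r w o‖ ^ 2 := by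
    rw [Finset.mul_sum, Finset.mul_sum]
    refine Finset.sum_le_sum fun v _ => ?_
    have hv : 1 / 2 < (gnomonic (r⁻¹ • w v) : EuclideanSpace ℝ (Fin (d + 1))) (Fin.last d) := hw v
    rw [gnomonic_last] at hv
    have h2 := gnomonicHeight_sq (r⁻¹ • w v)
    have h1 := gnomonicHeight_le_one (r⁻¹ • w v)
    simp only [chart]
    rw [ho, smul_zero, gnomonic_zero, norm_sub_northPole_sq, gnomonic_last]
    have h3 : ‖w v‖ ^ 2 = r ^ 2 * ‖r⁻¹ • w v‖ ^ 2 := by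
      rw [norm_smul, mul_pow, Real.norm_eq_abs, sq_abs]; field_simp
    rw [h3]
    have h4 : 1 / 4 * ‖r⁻¹ • w v‖ ^ 2 ≤ 2 - 2 * gnomonicHeight (r⁻¹ • w v) := by
      generalize gnomonicHeight (r⁻¹ • w v) = a at *
      generalize ‖r⁻¹ • w v‖ ^ 2 = x at *
      -- As `a ^ 2 * x = 1 - a ^ 2`, this amounts to `0 ≤ (1 - a) * (8 * a ^ 2 - a - 1)`, true for
      -- `1/2 < a ≤ 1`.
      have : a ^ 2 * (1 / 4 * x) ≤ a ^ 2 * (2 - 2 * a) := by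
        nlinarith [mul_nonneg (sub_nonneg.2 h1) (sq_nonneg a), mul_nonneg (sub_nonneg.2 h1)
          (mul_nonneg (by linarith : 0 ≤ a - 1 / 2) (by linarith : 0 ≤ a))]
      exact le_of_mul_le_mul_left this (by positivity)
    nlinarith [sq_nonneg r]
  calc c / 4 * ∑ v, ‖w v‖ ^ 2 = c * (1 / 4 * ∑ v, ‖w v‖ ^ 2) := by ring
    _ ≤ c * _ := mul_le_mul_of_nonneg_left key hc
    _ = _ := by ring

/-! ### Pointwise limits in the rescaled chart -/

theorem tendsto_gnomonicHeight {d : ℕ} (x : EuclideanSpace ℝ (Fin d)) :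
    Tendsto (fun r : ℝ => gnomonicHeight (r⁻¹ • x)) atTop (𝓝 1) := by
  have h : Tendsto (fun r : ℝ => r⁻¹ • x) atTop (𝓝 0) := by
    simpa using (tendsto_inv_atTop_zero (𝕜 := ℝ)).smul_const x
  have h0 : gnomonicHeight (0 : EuclideanSpace ℝ (Fin d)) = 1 := by simp [gnomonicHeight]
  rw [← h0]
  exact ((continuous_gnomonicHeight d).tendsto 0).comp h

/-- The height deficit is of order `r⁻²`, so after scaling by `r` the last coordinate contributes
nothing to the limiting energy. -/
theorem tendsto_mul_one_sub_gnomonicHeight {d : ℕ} (x : EuclideanSpace ℝ (Fin d)) :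
    Tendsto (fun r : ℝ => r * (1 - gnomonicHeight (r⁻¹ • x))) atTop (𝓝 0) := by
  have h : Tendsto (fun r : ℝ => r⁻¹ * ‖x‖ ^ 2) atTop (𝓝 0) := by
    simpa using tendsto_inv_atTop_zero.mul_const (‖x‖ ^ 2)
  refine squeeze_zero' ?_ ?_ h
  · filter_upwards [eventually_gt_atTop 0] with r hr
    exact mul_nonneg hr.le (sub_nonneg.2 (gnomonicHeight_le_one _))
  · filter_upwards [eventually_gt_atTop 0] with r hr
    have h1 := gnomonicHeight_le_one (r⁻¹ • x)
    have h2 := gnomonicHeight_sq (r⁻¹ • x)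
    have h0 := gnomonicHeight_pos (r⁻¹ • x)
    have h3 : r⁻¹ * ‖x‖ ^ 2 = r * ‖r⁻¹ • x‖ ^ 2 := by
      rw [norm_smul, mul_pow, Real.norm_eq_abs, sq_abs]; field_simp
    rw [h3]
    refine mul_le_mul_of_nonneg_left ?_ hr.le
    have h4 : (0 : ℝ) ≤ ‖r⁻¹ • x‖ ^ 2 := sq_nonneg _
    generalize gnomonicHeight (r⁻¹ • x) = a at *
    generalize ‖r⁻¹ • x‖ ^ 2 = y at *
    nlinarith [mul_nonneg (mul_nonneg h4 h0.le) (sub_nonneg.2 h1), mul_nonneg h4 (sub_nonneg.2 h1)]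

/-- The vertical part is written with deficits because `r` times a height diverges while `r` times a
deficit tends to `0`. -/
theorem sq_mul_norm_gnomonic_sub_sq {d : ℕ} {r : ℝ} (hr : r ≠ 0) (x y : EuclideanSpace ℝ (Fin d)) :
    r ^ 2 * ‖(gnomonic (r⁻¹ • x) : EuclideanSpace ℝ (Fin (d + 1))) - gnomonic (r⁻¹ • y)‖ ^ 2 =
      ‖gnomonicHeight (r⁻¹ • x) • x - gnomonicHeight (r⁻¹ • y) • y‖ ^ 2 +
        (r * (1 - gnomonicHeight (r⁻¹ • y)) - r * (1 - gnomonicHeight (r⁻¹ • x))) ^ 2 := by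
  have h : ∀ z : EuclideanSpace ℝ (Fin d),
      r • (gnomonic (r⁻¹ • z) : EuclideanSpace ℝ (Fin (d + 1))) =
        snocPoint d (gnomonicHeight (r⁻¹ • z) • z) (r * gnomonicHeight (r⁻¹ • z)) := by
    intro z
    rw [coe_gnomonic, smul_smul, ← snocPoint_smul, smul_smul, mul_right_comm,
      mul_inv_cancel₀ hr, one_mul, mul_one]
  rw [← sq_abs r, ← Real.norm_eq_abs, ← mul_pow, ← norm_smul, smul_sub, h, h, snocPoint_sub,
    norm_snocPoint_sq]
  ring

theorem tendsto_sq_mul_spinEnergy_chart {d : ℕ} (w : V → EuclideanSpace ℝ (Fin d)) :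
    Tendsto (fun r : ℝ => r ^ 2 * spinEnergy G (chart r w)) atTop
      (𝓝 (dirichletEnergy G d w)) := by
  unfold spinEnergy dirichletEnergy
  simp_rw [Finset.mul_sum]
  refine tendsto_finsetSum _ fun e _ => ?_
  induction e with
  | _ i j =>
    simp only [Sym2.lift_mk, chart]
    have hs : ∀ x : EuclideanSpace ℝ (Fin d),
        Tendsto (fun r : ℝ => gnomonicHeight (r⁻¹ • x) • x) atTop (𝓝 x) := fun x => by
      simpa using (tendsto_gnomonicHeight x).smul_const x
    have h := ((((hs (w i)).sub (hs (w j))).norm).pow 2).add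
      (((tendsto_mul_one_sub_gnomonicHeight (w j)).sub
        (tendsto_mul_one_sub_gnomonicHeight (w i))).pow 2)
    simp only [sub_self, ne_eq, OfNat.ofNat_ne_zero, not_false_eq_true, zero_pow, add_zero] at h
    refine h.congr' ?_
    filter_upwards [eventually_gt_atTop 0] with r hr
    exact (sq_mul_norm_gnomonic_sub_sq hr.ne' _ _).symm

/-! ### Convergence of the unnormalised integrals -/

theorem integrable_rootedProduct_gaussian (o : V) (d : ℕ) {b : ℝ} (hb : 0 < b) :
    Integrable (fun γ : V → EuclideanSpace ℝ (Fin d) => Real.exp (-b * ∑ v, ‖γ v‖ ^ 2))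
      (rootedProduct o 0 volume) := by
  simp_rw [Finset.mul_sum, Real.exp_sum]
  refine Integrable.fintype_prod
    (f := fun _ (x : EuclideanSpace ℝ (Fin d)) => Real.exp (-b * ‖x‖ ^ 2)) fun v => ?_
  split_ifs
  · exact integrable_dirac (by simp)
  · exact integrable_gaussian d hb

/-- The integrand of the partition function with test function `f`, up to normalisation. -/
def spinWeight {d : ℕ} (f : (V → EuclideanSpace ℝ (Fin d)) → ℝ) (r : ℝ) (σ : V → Spin (d + 1)) :
    ℝ :=
  Real.exp (-(r ^ 2 / 2) * spinEnergy G σ) * f (scaledProj r σ)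

theorem continuous_spinWeight {d : ℕ} {f : (V → EuclideanSpace ℝ (Fin d)) → ℝ}
    (hf : Continuous f) (r : ℝ) : Continuous (spinWeight G f r) :=
  (Real.continuous_exp.comp (continuous_const.mul (continuous_spinEnergy G (d + 1)))).mul
    (hf.comp (continuous_scaledProj d r))

theorem integrable_spinWeight {d : ℕ} {f : (V → EuclideanSpace ℝ (Fin d)) → ℝ}
    (hf : Continuous f) (r : ℝ) (μ : Measure (V → Spin (d + 1))) [IsFiniteMeasure μ] :
    Integrable (spinWeight G f r) μ :=
  (continuous_spinWeight G hf r).integrable_of_hasCompactSupport (HasCompactSupport.of_compactSpace _)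

theorem tendsto_integral_chart_cap {G : SimpleGraph V} [DecidableRel G.Adj] (hG : G.Connected)
    (o : V) {d : ℕ} {f : (V → EuclideanSpace ℝ (Fin d)) → ℝ} (hf : Continuous f) {C : ℝ}
    (hC : ∀ γ, |f γ| ≤ C) :
    Tendsto (fun r : ℝ => ∫ w, (∏ v, chartDensity r (w v)) *
        (cap V d).indicator (spinWeight G f r) (chart r w)
          ∂(rootedProduct o (0 : EuclideanSpace ℝ (Fin d)) volume)) atTop
      (𝓝 (∫ γ, Real.exp (-(1 / 2) * dirichletEnergy G d γ) * f γ
        ∂(rootedProduct o (0 : EuclideanSpace ℝ (Fin d)) volume))) := by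
  obtain ⟨c, hc, hcoer⟩ := spinEnergy_coercive hG o (d + 1)
  have hC0 : 0 ≤ C := (abs_nonneg _).trans (hC 0)
  refine tendsto_integral_filter_of_dominated_convergence
    -- The rate `c / 8` is the `c / 4` of `le_spinEnergy_chart` times the `1/2` in the weight.
    (fun γ => Real.exp (-(c / 8) * ∑ v, ‖γ v‖ ^ 2) * C) ?_ ?_ ?_ ?_
  · refine Eventually.of_forall fun r => Measurable.aestronglyMeasurable ?_
    refine Measurable.mul ?_ ?_
    · exact (continuous_finsetProd _ fun v _ =>
        (continuous_chartDensity d r).comp (continuous_apply v)).measurable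
    · exact ((continuous_spinWeight G hf r).measurable.indicator (measurableSet_cap d)).comp
        (continuous_chart d r).measurable
  · filter_upwards [eventually_gt_atTop 0] with r hr
    filter_upwards [rootedProduct_ae_root o (0 : EuclideanSpace ℝ (Fin d)) volume] with w h0
    have hprod0 : 0 ≤ ∏ v, chartDensity r (w v) :=
      Finset.prod_nonneg fun v _ => chartDensity_nonneg r _
    have hprod1 : ∏ v, chartDensity r (w v) ≤ 1 :=
      Finset.prod_le_one (fun v _ => chartDensity_nonneg r _) fun v _ => chartDensity_le_one r _
    rw [norm_mul, Real.norm_eq_abs, abs_of_nonneg hprod0]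
    refine (mul_le_of_le_one_left (norm_nonneg _) hprod1).trans ?_
    by_cases hw : chart r w ∈ cap V d
    · rw [Set.indicator_of_mem hw, spinWeight, norm_mul, Real.norm_eq_abs, Real.abs_exp]
      refine mul_le_mul (Real.exp_le_exp.2 ?_) (hC _) (norm_nonneg _) (Real.exp_nonneg _)
      have := le_spinEnergy_chart G hc.le hr (hcoer _) h0 hw
      linarith
    · rw [Set.indicator_of_notMem hw, norm_zero]
      positivity
  · exact (integrable_rootedProduct_gaussian o d (by positivity)).mul_const C
  · refine Eventually.of_forall fun w => ?_
    have h1 : Tendsto (fun r : ℝ => ∏ v, chartDensity r (w v)) atTop (𝓝 1) := by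
      have := tendsto_finsetProd Finset.univ fun v (_ : v ∈ Finset.univ) =>
        (tendsto_gnomonicHeight (w v)).pow (d + 1)
      simpa [chartDensity] using this
    have h2 : Tendsto (fun r : ℝ => spinWeight G f r (chart r w)) atTop
        (𝓝 (Real.exp (-(1 / 2) * dirichletEnergy G d w) * f w)) := by
      refine Tendsto.mul ?_ ?_
      · refine (Real.continuous_exp.tendsto _).comp ?_
        refine ((tendsto_sq_mul_spinEnergy_chart G w).const_mul (-(1 / 2))).congr fun r => ?_
        ring
      · refine (hf.tendsto w).comp ?_
        have : Tendsto (fun (r : ℝ) v => gnomonicHeight (r⁻¹ • w v) • w v) atTop (𝓝 w) :=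
          tendsto_pi_nhds.2 fun v => by
            simpa using (tendsto_gnomonicHeight (w v)).smul_const (w v)
        refine this.congr' ?_
        filter_upwards [eventually_gt_atTop 0] with r hr
        exact (scaledProj_chart hr.ne' w).symm
    -- For fixed `w` all spins tend to the pole, so the cutoff eventually disappears.
    have h3 : ∀ᶠ r : ℝ in atTop, chart r w ∈ cap V d := by
      refine eventually_all.2 fun v => ?_
      have := (tendsto_gnomonicHeight (w v)).eventually (lt_mem_nhds (by norm_num : (1 / 2 : ℝ) < 1))
      filter_upwards [this] with r hr
      simpa only [chart, gnomonic_last] using hr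
    have h4 := h1.mul h2
    rw [one_mul] at h4
    refine h4.congr' ?_
    filter_upwards [h3] with r hr
    rw [Set.indicator_of_mem hr]

theorem tendsto_integral_compl_cap {G : SimpleGraph V} [DecidableRel G.Adj] (hG : G.Connected)
    (o : V) {d : ℕ} {f : (V → EuclideanSpace ℝ (Fin d)) → ℝ} {C : ℝ}
    (hC : ∀ γ, |f γ| ≤ C) (m : ℕ) :
    Tendsto (fun r : ℝ => r ^ m * ∫ σ in (cap V d)ᶜ, spinWeight G f r σ
        ∂(rootedProduct o (northPole (d + 1) (Nat.succ_pos d)) (surface (d + 1)))) atTop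
      (𝓝 0) := by
  obtain ⟨c, hc, hcoer⟩ := spinEnergy_coercive hG o (d + 1)
  have hC0 : 0 ≤ C := (abs_nonneg _).trans (hC 0)
  set P := rootedProduct o (northPole (d + 1) (Nat.succ_pos d)) (surface (d + 1)) with hP
  -- The true decay is `exp (-(c / 2) * r ^ 2)`; since `r ≤ r ^ 2` for `r ≥ 1`, the weaker rate
  -- suffices.
  have hlim : Tendsto (fun r : ℝ => r ^ m * Real.exp (-(c / 2) * r) * (C * P.real (cap V d)ᶜ)) atTop
      (𝓝 0) := by
    have := tendsto_rpow_mul_exp_neg_mul_atTop_nhds_zero (m : ℝ) (c / 2) (by positivity)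
    simp only [Real.rpow_natCast] at this
    simpa using this.mul_const (C * P.real (cap V d)ᶜ)
  refine squeeze_zero_norm' ?_ hlim
  filter_upwards [eventually_ge_atTop 1] with r hr
  rw [norm_mul, Real.norm_of_nonneg (by positivity : 0 ≤ r ^ m), mul_assoc]
  refine mul_le_mul_of_nonneg_left ?_ (by positivity)
  rw [← mul_assoc]
  refine norm_setIntegral_le_of_norm_le_const_ae (measure_lt_top _ _) ?_
  rw [ae_restrict_iff' (measurableSet_cap d).compl]
  filter_upwards [rootedProduct_ae_root o (northPole (d + 1) (Nat.succ_pos d)) (surface (d + 1))]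
    with σ h0 hσ
  rw [spinWeight, norm_mul, Real.norm_eq_abs, Real.abs_exp]
  refine mul_le_mul (Real.exp_le_exp.2 ?_) (hC _) (norm_nonneg _) (Real.exp_nonneg _)
  have h1 := le_spinEnergy_of_notMem_cap G hc.le (hcoer σ) h0 hσ
  nlinarith [mul_le_mul_of_nonneg_left h1 (sq_nonneg r), mul_nonneg hc.le (sub_nonneg.2 hr)]

/-- The prefactor is the Jacobian of rescaling all spins but the root. The integral splits along
`cap`: the inside, contained in the hemispheres, passes to the chart, and the outside is negligible.
-/
theorem tendsto_partitionFunction {G : SimpleGraph V} [DecidableRel G.Adj] (hG : G.Connected)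
    (o : V) {d : ℕ} {f : (V → EuclideanSpace ℝ (Fin d)) → ℝ} (hf : Continuous f) {C : ℝ}
    (hC : ∀ γ, |f γ| ≤ C) :
    Tendsto (fun r : ℝ => (∏ v : V, if v = o then 1 else r ^ d) * ∫ σ, spinWeight G f r σ
        ∂(rootedProduct o (northPole (d + 1) (Nat.succ_pos d)) (surface (d + 1)))) atTop
      (𝓝 (∫ γ, Real.exp (-(1 / 2) * dirichletEnergy G d γ) * f γ
        ∂(rootedProduct o (0 : EuclideanSpace ℝ (Fin d)) volume))) := by
  have hpow : ∃ m : ℕ, ∀ r : ℝ, (∏ v : V, if v = o then 1 else r ^ d) = r ^ m := by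
    refine ⟨∑ v : V, if v = o then 0 else d, fun r => ?_⟩
    rw [← Finset.prod_pow_eq_pow_sum]
    refine Finset.prod_congr rfl fun v _ => ?_
    split_ifs <;> simp
  obtain ⟨m, hm⟩ := hpow
  have h := (tendsto_integral_chart_cap hG o hf hC).add (tendsto_integral_compl_cap hG o hC m)
  rw [add_zero] at h
  refine h.congr' ?_
  filter_upwards [eventually_gt_atTop 0] with r hr
  have hsub : (Set.univ.pi fun _ : V => upperHemisphere d) ∩ cap V d = cap V d :=
    Set.inter_eq_right.2 fun σ hσ v _ => lt_trans (by norm_num : (0 : ℝ) < 1 / 2) (hσ v)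
  rw [← integral_upperHemisphere_eq o d hr
      ((continuous_spinWeight G hf r).measurable.indicator (measurableSet_cap d)),
    setIntegral_indicator (measurableSet_cap d), hsub, ← hm, ← mul_add,
    integral_add_compl (measurableSet_cap d) (integrable_spinWeight G hf r _)]

/-! ### Normalisation and convergence in law -/

theorem integral_tilted_eq_div {α : Type*} [MeasurableSpace α] (μ : Measure α) (h g : α → ℝ) :
    ∫ x, g x ∂(μ.tilted h) = (∫ x, Real.exp (h x) * g x ∂μ) / ∫ x, Real.exp (h x) ∂μ := by
  rw [integral_tilted, ← integral_div]
  refine integral_congr_ae (Eventually.of_forall fun x => ?_)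
  simp only [smul_eq_mul]
  ring

theorem integral_rootedSpinMeasure (o : V) {d : ℕ} (f : (V → EuclideanSpace ℝ (Fin d)) → ℝ)
    {r : ℝ} (hr : 0 < r) :
    ∫ σ, f (scaledProj r σ) ∂(rootedSpinMeasure G o (d + 1) (Nat.succ_pos d) (r ^ 2)) =
      ((∏ v : V, if v = o then 1 else r ^ d) * ∫ σ, spinWeight G f r σ
        ∂(rootedProduct o (northPole (d + 1) (Nat.succ_pos d)) (surface (d + 1)))) /
      ((∏ v : V, if v = o then 1 else r ^ d) * ∫ σ, spinWeight G (fun _ => 1) r σ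
        ∂(rootedProduct o (northPole (d + 1) (Nat.succ_pos d)) (surface (d + 1)))) := by
  have hK : (∏ v : V, if v = o then 1 else r ^ d) ≠ 0 :=
    Finset.prod_ne_zero_iff.2 fun v _ => by split_ifs <;> positivity
  rw [mul_div_mul_left _ _ hK, rootedSpinMeasure, integral_tilted_eq_div]
  simp_rw [neg_mul_hamiltonian, Real.exp_add, mul_assoc, spinWeight]
  rw [integral_const_mul, integral_const_mul, mul_div_mul_left _ _ (Real.exp_ne_zero _)]
  simp only [mul_one]

theorem tendsto_integral_rootedSpinMeasure {G : SimpleGraph V} [DecidableRel G.Adj]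
    (hG : G.Connected) (o : V) {d : ℕ} {f : (V → EuclideanSpace ℝ (Fin d)) → ℝ}
    (hf : Continuous f) {C : ℝ} (hC : ∀ γ, |f γ| ≤ C) :
    Tendsto (fun β : ℝ => ∫ σ, f (scaledProj (Real.sqrt β) σ)
        ∂(rootedSpinMeasure G o (d + 1) (Nat.succ_pos d) β)) atTop
      (𝓝 (∫ γ, f γ ∂(rootedGFFMeasure G o d))) := by
  have hZ : ∫ γ, Real.exp (-(1 / 2) * dirichletEnergy G d γ) * 1
      ∂(rootedProduct o (0 : EuclideanSpace ℝ (Fin d)) volume) ≠ 0 := by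
    have hprob := isProbabilityMeasure_rootedGFFMeasure G hG o d
    have : NeZero (rootedProduct o (0 : EuclideanSpace ℝ (Fin d)) volume) :=
      ⟨rootedProduct_ne_zero _ _ _ (NeZero.ne _)⟩
    simp only [mul_one]
    -- Tilting by a non-integrable exponential gives the zero measure, which is not a probability
    -- measure; so the Gaussian weight is integrable and its integral positive.
    refine (integral_exp_pos (not_not.1 fun hi => ?_)).ne'
    exact hprob.ne_zero _ (tilted_of_not_integrable hi)
  have h := ((tendsto_partitionFunction hG o hf hC).div
    (tendsto_partitionFunction hG o (f := fun _ => 1) continuous_const (C := 1) (by simp)) hZ).comp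
      Real.tendsto_sqrt_atTop
  have hlim : ∫ γ, f γ ∂(rootedGFFMeasure G o d) =
      (∫ γ, Real.exp (-(1 / 2) * dirichletEnergy G d γ) * f γ
        ∂(rootedProduct o (0 : EuclideanSpace ℝ (Fin d)) volume)) /
      ∫ γ, Real.exp (-(1 / 2) * dirichletEnergy G d γ) * 1
        ∂(rootedProduct o (0 : EuclideanSpace ℝ (Fin d)) volume) := by
    rw [rootedGFFMeasure, integral_tilted_eq_div]
    simp only [mul_one]
  rw [hlim]
  refine h.congr' ?_
  filter_upwards [eventually_gt_atTop 0] with β hβ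
  have := integral_rootedSpinMeasure G o f (Real.sqrt_pos.2 hβ)
  rw [Real.sq_sqrt hβ.le] at this
  exact this.symm

end Limit

end SpinON

end

theorem theorem5 {V : Type*} [Fintype V] [DecidableEq V] (G : SimpleGraph V)
    [DecidableRel G.Adj] (hG : G.Connected) (o : V) (N : ℕ) (hN : 2 ≤ N) :
    TendstoInDistribution
      (fun (β : ℝ) (σ : V → SpinON.Spin N) => SpinON.rescaledField N β σ) atTop
      (fun γ : V → EuclideanSpace ℝ (Fin (N - 1)) => γ)
      (fun β => (SpinON.rootedSpinLaw G o N (by omega) β : Measure (V → SpinON.Spin N)))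
      (SpinON.rootedGFFLaw G hG o (N - 1) :
        Measure (V → EuclideanSpace ℝ (Fin (N - 1)))) := by
  obtain ⟨d, rfl⟩ : ∃ d, N = d + 1 := ⟨N - 1, by omega⟩
  -- `rescaledField (d + 1) β` agrees definitionally with `scaledProj (√β)`, as `d + 1 - 1` reduces
  -- to `d`.
  have hcont : ∀ β : ℝ, Continuous fun σ : V → SpinON.Spin (d + 1) =>
      SpinON.rescaledField (d + 1) β σ := fun β => SpinON.continuous_scaledProj d (Real.sqrt β)
  refine ⟨fun β => (hcont β).measurable.aemeasurable, measurable_id.aemeasurable, ?_⟩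
  refine ProbabilityMeasure.tendsto_iff_forall_integral_tendsto.2 ?_
  intro f
  have h := SpinON.tendsto_integral_rootedSpinMeasure hG o f.continuous (C := ‖f‖)
    fun γ => f.norm_coe_le_norm γ
  simp only [ProbabilityMeasure.coe_mk]
  rw [Measure.map_id']
  refine h.congr fun β => ?_
  rw [integral_map (hcont β).measurable.aemeasurable f.continuous.aestronglyMeasurable]
  rfl
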